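/- All graphs are finite and simple, and $\log$ is the natural logarithm. A total-coloring of a graph $G$ colors all its vertices and edges; it is a TMC-coloring if any two vertices of $G$ are connected by a path all of whose edges and internal vertices have the same color. For connected $G$, let $tmc(G)$ be the maximum number of colors used in a TMC-coloring of $G$; for disconnected $G$, let $tmc(G)=0$. Let $G(n,p)$ be the random graph on $n$ vertices in which each pair is an edge independently with probability $p$. For $p=p(n)\in[0,1]$, a property holds almost surely for $G(n,p)$ if its probability tends to $1$ as $n\to\infty$. A function $t(n)$ is called a sharp threshold function for a graph property $P$ if there are constants $C,c>0$ such that $G(n,p)$ almost surely satisfies $P$ for every $p=p(n)\in[0,1]$ with $p(n)\ge\min\{1,C\,t(n)\}$ for all sufficiently large $n$, and such that $c\,t(n)\in[0,1]$ for all sufficiently large $n$ and $G(n,c\,t(n))$ almost surely does not satisfy $P$. **Theorem.** Let $f$ be a real-valued function on the natural numbers with $1\le f(n)<\frac12 n(n-1)+n$ for all sufficiently large $n$. 1. If there is a constant $l>0$ such that $l\,n\log n\le f(n)$ for all sufficiently large $n$, then $$p=\frac{f(n)+n\log\log n}{n^2}$$ is a sharp threshold function for the property $tmc(G(n,p))\ge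 f(n)$. 2. If $f(n)=o(n\log n)$, then $$p=\frac{\log n}{n}$$ is a sharp threshold function for the property $tmc(G(n,p))\ge f(n)$. -/

import Mathlib

open Filter Topology Asymptotics

noncomputable section

namespace TMC

/-- A total coloring (`χ (.inl v)` is the color of the vertex `v`, `χ (.inr e)` that of the edge
`e`) is a TMC-coloring if any two vertices are joined by a path all of whose edges and internal
vertices have the same color. -/
def IsTMCColoring {V : Type*} (G : SimpleGraph V) (χ : V ⊕ G.edgeSet → ℕ) : Prop :=
  ∀ u v : V, ∃ p : G.Walk u v, p.IsPath ∧ ∃ c : ℕ,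
    (∀ (e : Sym2 V) (he : e ∈ p.edges), χ (.inr ⟨e, p.edges_subset_edgeSet he⟩) = c) ∧
    (∀ w ∈ p.support, w ≠ u → w ≠ v → χ (.inl w) = c)

open Classical in
/-- The total monochromatic connection number of a finite graph: the maximum number of colors used
in a TMC-coloring if the graph is connected, and `0` otherwise. -/
def tmc {V : Type*} (G : SimpleGraph V) : ℕ :=
  if G.Connected then
    sSup {k : ℕ | ∃ χ : V ⊕ G.edgeSet → ℕ, IsTMCColoring G χ ∧ (Set.range χ).ncard = k}
  else 0

/-- `G(n, p(n))` satisfies the graph property `P` with probability tending to `1`. -/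
def AlmostSurely (P : ∀ n : ℕ, SimpleGraph (Fin n) → Prop) (p : ℕ → unitInterval) : Prop :=
  Tendsto (fun n => SimpleGraph.binomialRandom (Fin n) (p n) {G | P n G}) atTop (𝓝 1)

/-- `t` is a sharp threshold function for `P`: there are constants `C, c > 0` such that
`G(n, p)` almost surely satisfies `P` for every `p = p(n) ≥ C t(n)`, and `G(n, c t(n))` almost
surely does not satisfy `P`. Where `C t(n) > 1`, the bound on `p(n)` is read as `p(n) = 1`; and
`c t(n)` has to be a probability for all large `n`. -/
def IsSharpThreshold (t : ℕ → ℝ) (P : ∀ n : ℕ, SimpleGraph (Fin n) → Prop) : Prop :=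
  ∃ C c : ℝ, 0 < C ∧ 0 < c ∧
    (∀ p : ℕ → unitInterval, (∀ᶠ n in atTop, min 1 (C * t n) ≤ (p n : ℝ)) →
      AlmostSurely P p) ∧
    (∃ q : ℕ → unitInterval, (∀ᶠ n in atTop, (q n : ℝ) = c * t n) ∧
      AlmostSurely (fun n G => ¬ P n G) q)

end TMC

end

/-! For connected `G` with `m` edges on `n` vertices, `m - n + 1 ≤ tmc G ≤ m + n`
(`ncard_edgeSet_lt_tmc_add`, `tmc_le`). So if `f n ≥ l n log n`, where `n` is negligible, `tmc G ≥ f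
n` amounts up to constant factors to connectedness together with `m ≥ f n`. The edge count is
concentrated by Chebyshev, `f n / n ^ 2` dominates the connectivity threshold `log n / n`, and the
term `n log log n` is absorbed into the constants.

If `f n = o(n log n)`, the edges present at the connectivity threshold already suffice, and below it
`tmc G = 0 < f n`. Connectivity is settled by a union bound over cuts
(`binomialRandom_real_not_connected_le`) and by a second moment bound on isolated vertices
(`binomialRandom_real_connected_le`). -/

namespace TMC

/-! ### Deterministic bounds on `tmc` and cuts of disconnected graphs -/

section Graph

variable {V : Type*} [Finite V] {G : SimpleGraph V}

theorem ncard_range_le (χ : V ⊕ G.edgeSet → ℕ) :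
    (Set.range χ).ncard ≤ Nat.card V + G.edgeSet.ncard := by
  rw [← Set.image_univ]
  refine (Set.ncard_image_le).trans ?_
  rw [Set.ncard_univ, Nat.card_sum, Nat.card_coe_set_eq]

theorem tmc_le (G : SimpleGraph V) : tmc G ≤ Nat.card V + G.edgeSet.ncard := by
  unfold tmc
  split_ifs
  · rcases Set.eq_empty_or_nonempty
      {k : ℕ | ∃ χ : V ⊕ G.edgeSet → ℕ, IsTMCColoring G χ ∧ (Set.range χ).ncard = k} with h | h
    · simp [h]
    · refine csSup_le h ?_
      rintro k ⟨χ, -, rfl⟩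
      exact ncard_range_le χ
  · exact Nat.zero_le _

theorem IsTMCColoring.ncard_range_le_tmc (hG : G.Connected) {χ : V ⊕ G.edgeSet → ℕ}
    (hχ : IsTMCColoring G χ) : (Set.range χ).ncard ≤ tmc G := by
  rw [tmc, if_pos hG]
  refine le_csSup ⟨Nat.card V + G.edgeSet.ncard, ?_⟩ ⟨χ, hχ, rfl⟩
  rintro k ⟨χ', -, rfl⟩
  exact ncard_range_le χ'

/-- Give a spanning tree and all vertices one color, and distinct further colors to the
remaining edges. -/
theorem ncard_edgeSet_lt_tmc_add (hG : G.Connected) :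
    G.edgeSet.ncard + 1 ≤ tmc G + Nat.card V := by
  classical
  obtain ⟨T, hTG, hT⟩ := hG.exists_isTree_le
  obtain ⟨g, hg⟩ := Countable.exists_injective_nat (Sym2 V)
  let χ : V ⊕ G.edgeSet → ℕ :=
    Sum.elim (fun _ => 0) (fun e => if e.1 ∈ T.edgeSet then 0 else g e.1 + 1)
  have hχ : IsTMCColoring G χ := by
    intro u v
    obtain ⟨p, hp⟩ := (hT.connected.preconnected u v).exists_isPath
    refine ⟨p.mapLe hTG, hp.mapLe hTG, 0, fun e he => ?_, fun w _ _ _ => rfl⟩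
    have he' : e ∈ T.edgeSet := by
      apply p.edges_subset_edgeSet
      simpa using he
    simp [χ, he']
  have hcard := hχ.ncard_range_le_tmc hG
  -- Only the non-tree edges are counted; the color `0` of the tree is given away, as the bound need
  -- not be sharp.
  have himg : (fun e => g e + 1) '' (G.edgeSet \ T.edgeSet) ⊆ Set.range χ := by
    rintro _ ⟨e, ⟨heG, heT⟩, rfl⟩
    exact ⟨.inr ⟨e, heG⟩, by simp [χ, heT]⟩
  have hle := Set.ncard_le_ncard himg (Set.toFinite _)
  rw [Set.ncard_image_of_injective _ (fun a b h => hg (Nat.succ_injective h)),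
    Set.ncard_sdiff (SimpleGraph.edgeSet_mono hTG) (Set.toFinite _)] at hle
  cases nonempty_fintype V
  have htree := hT.card_edgeFinset
  rw [← Nat.card_eq_fintype_card, ← Set.ncard_coe_finset, SimpleGraph.coe_edgeFinset] at htree
  omega

/-- Paths of length at most one have no internal vertices, so an injective coloring is admissible.
This serves the case `p = 1`, where `f n` may be too large for the spanning tree bound. -/
theorem card_add_ncard_edgeSet_le_tmc_top [Nonempty V] :
    Nat.card V + (⊤ : SimpleGraph V).edgeSet.ncard ≤ tmc (⊤ : SimpleGraph V) := by
  classical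
  obtain ⟨g, hg⟩ := Countable.exists_injective_nat (V ⊕ (⊤ : SimpleGraph V).edgeSet)
  have hχ : IsTMCColoring (⊤ : SimpleGraph V) g := by
    intro u v
    by_cases huv : u = v
    · subst huv
      exact ⟨.nil, .nil, 0, by simp, by simp⟩
    · have hadj : (⊤ : SimpleGraph V).Adj u v := huv
      refine ⟨hadj.toWalk, .of_adj hadj, g (.inr ⟨s(u, v), hadj⟩), ?_, ?_⟩
      · intro e he
        have : e = s(u, v) := by simpa using he
        subst this
        rfl
      · intro w hw h1 h2
        simp at hw
        tauto
  have hcard := hχ.ncard_range_le_tmc SimpleGraph.connected_top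
  rwa [← Set.image_univ, Set.ncard_image_of_injective _ hg, Set.ncard_univ, Nat.card_sum,
    Nat.card_coe_set_eq] at hcard

/-- A disconnected graph has no edges across some cut, one side of which has at most half of the
vertices. -/
theorem exists_cut_of_not_connected {V : Type*} [Fintype V] [DecidableEq V] [Nonempty V]
    {G : SimpleGraph V} (hG : ¬ G.Connected) :
    ∃ S : Finset V, S.Nonempty ∧ 2 * S.card ≤ Fintype.card V ∧
      ∀ u ∈ S, ∀ v ∈ Sᶜ, ¬ G.Adj u v := by
  classical
  rw [SimpleGraph.connected_iff] at hG
  simp only [SimpleGraph.Preconnected, not_and_or, not_forall] at hG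
  rcases hG with ⟨a, b, hab⟩ | h
  swap
  · exact absurd ‹_› h
  let A : Finset V := Finset.univ.filter fun v => G.Reachable a v
  have hA : ∀ u ∈ A, ∀ v ∈ Aᶜ, ¬ G.Adj u v := by
    intro u hu v hv huv
    simp only [A, Finset.mem_filter, Finset.mem_univ, true_and, Finset.mem_compl] at hu hv
    exact hv (hu.trans huv.reachable)
  have hcard := Finset.card_add_card_compl A
  by_cases h : 2 * A.card ≤ Fintype.card V
  · exact ⟨A, ⟨a, by simp [A]⟩, h, hA⟩
  · refine ⟨Aᶜ, ⟨b, by simp [A, hab]⟩, by omega, ?_⟩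
    intro u hu v hv huv
    rw [compl_compl] at hv
    exact hA v hv u hu huv.symm

end Graph

end TMC

open MeasureTheory ProbabilityTheory

/-! ### The second moment method -/

section SecondMoment

variable {Ω ι : Type*} [MeasurableSpace Ω] {μ : Measure Ω} [IsProbabilityMeasure μ]

/-- Chebyshev's inequality for the number of events that occur in a family of events that is
almost pairwise negatively correlated. -/
theorem measureReal_le_abs_sum_indicator_sub {A : ι → Set Ω} {s : Finset ι} {a δ ε : ℝ}
    (hA : ∀ i ∈ s, MeasurableSet (A i)) (ha : ∑ i ∈ s, μ.real (A i) = a) (hδ : 0 ≤ δ)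
    (hpair : ∀ i ∈ s, ∀ j ∈ s, i ≠ j →
      μ.real (A i ∩ A j) ≤ (1 + δ) * (μ.real (A i) * μ.real (A j))) (hε : 0 < ε) :
    μ.real {ω | ε ≤ |∑ i ∈ s, (A i).indicator (fun _ => (1 : ℝ)) ω - a|} ≤
      (a + δ * a ^ 2) / ε ^ 2 := by
  classical
  let X : Ω → ℝ := fun ω => ∑ i ∈ s, (A i).indicator (fun _ => (1 : ℝ)) ω
  have hint : ∀ i ∈ s, Integrable ((A i).indicator (fun _ => (1 : ℝ))) μ := fun i hi =>
    (integrable_const _).indicator (hA i hi)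
  have hint2 : ∀ i ∈ s, ∀ j ∈ s, Integrable ((A i ∩ A j).indicator (fun _ => (1 : ℝ))) μ :=
    fun i hi j hj => (integrable_const _).indicator ((hA i hi).inter (hA j hj))
  have hX : Integrable X μ := integrable_finsetSum _ hint
  have hEX : ∫ ω, X ω ∂μ = a := by
    rw [← ha, integral_finsetSum _ hint]
    refine Finset.sum_congr rfl fun i hi => ?_
    rw [integral_indicator_const _ (hA i hi)]; simp
  have hXsq : (fun ω => X ω ^ 2) =
      fun ω => ∑ i ∈ s, ∑ j ∈ s, (A i ∩ A j).indicator (fun _ => (1 : ℝ)) ω := by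
    funext ω
    simp only [X, sq, Finset.sum_mul_sum]
    refine Finset.sum_congr rfl fun i _ => Finset.sum_congr rfl fun j _ => ?_
    by_cases hi : ω ∈ A i <;> by_cases hj : ω ∈ A j <;> simp [hi, hj]
  have hXsq_int : Integrable (fun ω => X ω ^ 2) μ := by
    rw [hXsq]
    exact integrable_finsetSum _ fun i hi => integrable_finsetSum _ fun j hj => hint2 i hi j hj
  have hEXsq : ∫ ω, X ω ^ 2 ∂μ ≤ a + (1 + δ) * a ^ 2 := by
    rw [hXsq, integral_finsetSum _ fun i hi =>
      integrable_finsetSum _ fun j hj => hint2 i hi j hj]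
    have : ∀ i ∈ s, ∫ ω, ∑ j ∈ s, (A i ∩ A j).indicator (fun _ => (1 : ℝ)) ω ∂μ ≤
        μ.real (A i) + (1 + δ) * (μ.real (A i) * a) := by
      intro i hi
      rw [integral_finsetSum _ fun j hj => hint2 i hi j hj, ← ha, Finset.mul_sum, Finset.mul_sum]
      -- The diagonal pair `j = i` gets a separate term, since its probability is not bounded by the
      -- product; summed over `i` these terms give `a`.
      have hsum : ∑ j ∈ s, (if i = j then μ.real (A i) else 0) = μ.real (A i) := by
        simp [hi]
      refine le_of_le_of_eq ?_ (congrArg (· + _) hsum)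
      rw [← Finset.sum_add_distrib]
      refine Finset.sum_le_sum fun j hj => ?_
      rw [integral_indicator_const _ ((hA i hi).inter (hA j hj))]
      have h0 : 0 ≤ (1 + δ) * (μ.real (A i) * μ.real (A j)) := by positivity
      split_ifs with h
      · subst h
        simp only [Set.inter_self, smul_eq_mul, mul_one]
        linarith
      · simpa using hpair i hi j hj h
    refine (Finset.sum_le_sum this).trans_eq ?_
    rw [Finset.sum_add_distrib, ← Finset.mul_sum, ← Finset.sum_mul, ha]
    ring
  have hvar_eq : (fun ω => (X ω - a) ^ 2) = fun ω => (X ω ^ 2 - 2 * a * X ω) + a ^ 2 := by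
    funext ω; ring
  have hdiff_int : Integrable (fun ω => X ω ^ 2 - 2 * a * X ω) μ :=
    hXsq_int.sub (hX.const_mul _)
  have hvar_int : Integrable (fun ω => (X ω - a) ^ 2) μ := by
    rw [hvar_eq]
    exact hdiff_int.add (integrable_const _)
  have hvar : ∫ ω, (X ω - a) ^ 2 ∂μ ≤ a + δ * a ^ 2 := by
    rw [hvar_eq, integral_add hdiff_int (integrable_const _),
      integral_sub hXsq_int (hX.const_mul _), integral_const_mul, hEX]
    simp only [integral_const, probReal_univ, smul_eq_mul, one_mul]
    linarith
  have hmarkov := mul_meas_ge_le_integral_of_nonneg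
    (ae_of_all μ fun ω => sq_nonneg (X ω - a)) hvar_int (ε ^ 2)
  rw [le_div_iff₀ (by positivity), mul_comm]
  refine le_trans (mul_le_mul_of_nonneg_left (measureReal_mono ?_) (by positivity))
    (hmarkov.trans hvar)
  intro ω hω
  simp only [Set.mem_ofPred_eq] at hω ⊢
  rw [← sq_abs (X ω - a)]
  exact pow_le_pow_left₀ hε.le hω 2

end SecondMoment

/-! ### Edge events and the edge count in the binomial random graph -/

namespace SimpleGraph

variable {V : Type*}

theorem measurableSet_of_finite [Finite V] (S : Set (SimpleGraph V)) : MeasurableSet S := by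
  rw [← measurableEmbedding_edgeSet.measurableSet_image]
  exact (Set.toFinite _).measurableSet

/-- Taking `t = {True}` or `t = {False}` treats presence and absence of edges together. Loops are
excluded because their coordinates are never edges. -/
theorem binomialRandom_forall_mem_edgeSet_mem [Finite V] (p : unitInterval)
    {s : Finset (Sym2 V)} (hs : ∀ e ∈ s, ¬ e.IsDiag) (t : Set Prop) :
    binomialRandom V p {G | ∀ e ∈ s, (e ∈ G.edgeSet) ∈ t} =
      (unitInterval.toNNReal p * t.indicator 1 True +
        unitInterval.toNNReal (unitInterval.symm p) * t.indicator 1 False) ^ s.card := by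
  rw [binomialRandom_eq_map, Measure.map_apply measurable_fromEdgeSet (measurableSet_of_finite _),
    setBernoulli_apply']
  have hpre : (fun x : Sym2 V → Prop => {e | x e}) ⁻¹' (fromEdgeSet ⁻¹'
      {G : SimpleGraph V | ∀ e ∈ s, (e ∈ G.edgeSet) ∈ t}) = Set.pi s fun _ => t := by
    ext x
    simp only [Set.mem_preimage, Set.mem_ofPred_eq, Set.mem_pi, Finset.mem_coe,
      edgeSet_fromEdgeSet]
    refine forall₂_congr fun e he => ?_
    have : (e ∈ {e | x e} \ Sym2.diagSet) = x e := by
      simp [hs e he]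
    rw [this]
  rw [hpre, Measure.infinitePi_pi _ fun _ _ => MeasurableSet.of_discrete]
  refine Finset.prod_eq_pow_card fun e he => ?_
  simp [hs e he]
  rfl

theorem binomialRandom_real_forall_mem_edgeSet [Finite V] (p : unitInterval)
    {s : Finset (Sym2 V)} (hs : ∀ e ∈ s, ¬ e.IsDiag) :
    (binomialRandom V p).real {G | ∀ e ∈ s, e ∈ G.edgeSet} = (p : ℝ) ^ s.card := by
  have h := binomialRandom_forall_mem_edgeSet_mem p hs {True}
  simp only [Set.mem_singleton_iff, eq_iff_iff, iff_true] at h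
  simp [measureReal_def, h]

theorem binomialRandom_real_forall_notMem_edgeSet [Finite V] (p : unitInterval)
    {s : Finset (Sym2 V)} (hs : ∀ e ∈ s, ¬ e.IsDiag) :
    (binomialRandom V p).real {G | ∀ e ∈ s, e ∉ G.edgeSet} = (1 - p : ℝ) ^ s.card := by
  have h := binomialRandom_forall_mem_edgeSet_mem p hs {False}
  simp only [Set.mem_singleton_iff, eq_iff_iff, iff_false] at h
  simp [measureReal_def, h]

theorem binomialRandom_real_mem_edgeSet [Finite V] (p : unitInterval) {e : Sym2 V} (he : ¬ e.IsDiag) :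
    (binomialRandom V p).real {G | e ∈ G.edgeSet} = p := by
  simpa using binomialRandom_real_forall_mem_edgeSet p (s := {e}) (by simpa using he)

variable [Fintype V] [DecidableEq V]

theorem sum_indicator_mem_edgeSet (G : SimpleGraph V) :
    ∑ e ∈ (⊤ : SimpleGraph V).edgeFinset,
      ({G | e ∈ G.edgeSet} : Set (SimpleGraph V)).indicator (fun _ => (1 : ℝ)) G =
        G.edgeSet.ncard := by
  classical
  have h : (⊤ : SimpleGraph V).edgeFinset.filter (fun e => e ∈ G.edgeSet) = G.edgeFinset := by
    ext e
    simp only [Finset.mem_filter, mem_edgeFinset, and_iff_right_iff_imp]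
    exact fun he => edgeSet_mono le_top he
  rw [← coe_edgeFinset G, Set.ncard_coe_finset, ← h, Finset.card_filter]
  push_cast
  exact Finset.sum_congr rfl fun e _ => by simp [Set.indicator_apply]

/-- The number of edges of `G(V, p)` is concentrated around its mean. -/
theorem binomialRandom_real_half_le_abs_ncard_edgeSet_sub (p : unitInterval) {a : ℝ}
    (ha : ((Fintype.card V).choose 2 : ℝ) * p = a) (ha0 : 0 < a) :
    (binomialRandom V p).real {G | a / 2 ≤ |(G.edgeSet.ncard : ℝ) - a|} ≤ 4 / a := by
  have hdiag : ∀ e ∈ (⊤ : SimpleGraph V).edgeFinset, ¬ e.IsDiag := by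
    intro e he
    exact not_isDiag_of_mem_edgeFinset he
  have hsum : ∑ e ∈ (⊤ : SimpleGraph V).edgeFinset,
      (binomialRandom V p).real {G | e ∈ G.edgeSet} = a := by
    rw [Finset.sum_congr rfl fun e he => binomialRandom_real_mem_edgeSet p (hdiag e he),
      Finset.sum_const, card_edgeFinset_top_eq_card_choose_two, nsmul_eq_mul, ha]
  have h := measureReal_le_abs_sum_indicator_sub (μ := binomialRandom V p)
    (A := fun e => {G | e ∈ G.edgeSet}) (s := (⊤ : SimpleGraph V).edgeFinset) (δ := 0)
    (ε := a / 2) (fun e _ => measurableSet_of_finite _) hsum le_rfl ?_ (by positivity)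
  · simp only [sum_indicator_mem_edgeSet] at h
    refine h.trans_eq ?_
    field_simp
    ring
  · intro e he e' he' hne
    rw [binomialRandom_real_mem_edgeSet p (hdiag e he),
      binomialRandom_real_mem_edgeSet p (hdiag e' he')]
    have hpair := binomialRandom_real_forall_mem_edgeSet p (s := {e, e'})
      (by simpa using ⟨hdiag e he, hdiag e' he'⟩)
    rw [Finset.card_pair hne] at hpair
    simp only [Finset.mem_insert, Finset.mem_singleton, forall_eq_or_imp, forall_eq] at hpair
    rw [← Set.ofPred_and, hpair]
    exact le_of_eq (by ring)

/-! ### Connectivity: empty cuts and isolated vertices -/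

/-- The probability that `G(V, p)` has no edge across a given cut. -/
theorem binomialRandom_real_forall_not_adj_compl (p : unitInterval) (S : Finset V) :
    (binomialRandom V p).real {G | ∀ u ∈ S, ∀ v ∈ Sᶜ, ¬ G.Adj u v} =
      (1 - p : ℝ) ^ (S.card * Sᶜ.card) := by
  have hinj : Set.InjOn (fun x : V × V => s(x.1, x.2)) (S ×ˢ Sᶜ : Finset (V × V)) := by
    rintro ⟨a, b⟩ hab ⟨c, d⟩ hcd h
    simp only [Finset.coe_product, Set.mem_prod, Finset.mem_coe, Finset.mem_compl] at hab hcd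
    simp only [Sym2.eq_iff] at h
    rcases h with ⟨rfl, rfl⟩ | ⟨rfl, rfl⟩
    · rfl
    · exact absurd hab.1 hcd.2
  rw [← Finset.card_product, ← Finset.card_image_of_injOn hinj,
    ← binomialRandom_real_forall_notMem_edgeSet]
  · congr 1
    ext G
    simp only [Set.mem_ofPred_eq, Finset.forall_mem_image, Finset.mem_product, mem_edgeSet,
      Prod.forall]
    exact ⟨fun h a b hab => h a hab.1 b hab.2, fun h a ha b hb => h a b ⟨ha, hb⟩⟩
  · simp only [Finset.forall_mem_image, Finset.mem_product, Finset.mem_compl, Sym2.mk_isDiag_iff,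
      Prod.forall]
    rintro a b ⟨ha, hb⟩ rfl
    exact hb ha

/-- Union bound over cuts: if `|S| ≤ n / 2`, the complement has at least `n / 2` vertices, so the
cut is empty with probability at most `x ^ |S|`. Summing over all nonempty `S` gives `(1 + x) ^ n -
1`. -/
theorem binomialRandom_real_not_connected_le [Nonempty V] (p : unitInterval) :
    (binomialRandom V p).real {G | ¬ G.Connected} ≤
      Real.exp (Fintype.card V * Real.exp (-(p * Fintype.card V / 2))) - 1 := by
  set n := Fintype.card V with hn
  set x := Real.exp (-(p * n / 2 : ℝ)) with hx
  have hx0 : 0 ≤ x := (Real.exp_pos _).le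
  let F : Finset (Finset V) := Finset.univ.filter fun S => S.Nonempty ∧ 2 * S.card ≤ n
  have hsub : {G : SimpleGraph V | ¬ G.Connected} ⊆
      ⋃ S ∈ F, {G | ∀ u ∈ S, ∀ v ∈ Sᶜ, ¬ G.Adj u v} := by
    intro G hG
    obtain ⟨S, hS, hcard, hcut⟩ := TMC.exists_cut_of_not_connected hG
    simp only [Set.mem_iUnion]
    exact ⟨S, by simp [F, hS, hcard, hn], hcut⟩
  have hterm : ∀ S ∈ F, (binomialRandom V p).real {G | ∀ u ∈ S, ∀ v ∈ Sᶜ, ¬ G.Adj u v} ≤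
      x ^ S.card := by
    intro S hS
    simp only [F, Finset.mem_filter, Finset.mem_univ, true_and] at hS
    rw [binomialRandom_real_forall_not_adj_compl, mul_comm, pow_mul]
    have hp1 : (0 : ℝ) ≤ 1 - p := by linarith [p.2.2]
    refine pow_le_pow_left₀ (by positivity) ?_ _
    refine (pow_le_pow_left₀ hp1 (Real.one_sub_le_exp_neg p) _).trans ?_
    rw [← Real.exp_nat_mul, hx, Real.exp_le_exp]
    have hc : S.card + Sᶜ.card = n := Finset.card_add_card_compl S
    have hc' : (n : ℝ) / 2 ≤ Sᶜ.card := by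
      rw [div_le_iff₀ (by norm_num)]
      exact_mod_cast (by omega : n ≤ Sᶜ.card * 2)
    nlinarith [p.2.1]
  have hall : ∑ S : Finset V, x ^ S.card = (1 + x) ^ n := by
    have := Fintype.sum_pow_mul_eq_add_pow V x 1
    simpa [add_comm] using this
  calc (binomialRandom V p).real {G | ¬ G.Connected}
      ≤ ∑ S ∈ F, (binomialRandom V p).real {G | ∀ u ∈ S, ∀ v ∈ Sᶜ, ¬ G.Adj u v} :=
        (measureReal_mono hsub (measure_ne_top _ _)).trans (measureReal_biUnion_finset_le _ _)
    _ ≤ ∑ S ∈ F, x ^ S.card := Finset.sum_le_sum hterm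
    _ ≤ ∑ S ∈ (Finset.univ : Finset (Finset V)).erase ∅, x ^ S.card := by
        refine Finset.sum_le_sum_of_subset_of_nonneg ?_ fun _ _ _ => by positivity
        intro S hS
        simp only [F, Finset.mem_filter, Finset.mem_univ, true_and] at hS
        simpa using hS.1.ne_empty
    _ = (1 + x) ^ n - 1 := by
        rw [← hall, ← Finset.add_sum_erase _ _ (Finset.mem_univ (∅ : Finset V))]
        simp
    _ ≤ Real.exp (n * x) - 1 := by
        rw [Real.exp_nat_mul]
        gcongr
        rw [add_comm]
        exact Real.add_one_le_exp x

theorem setOf_isolated_eq (v : V) :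
    {G : SimpleGraph V | ∀ w, ¬ G.Adj v w} =
      {G | ∀ e ∈ (⊤ : SimpleGraph V).incidenceFinset v, e ∉ G.edgeSet} := by
  ext G
  simp only [Set.mem_ofPred_eq, mem_incidenceFinset]
  constructor
  · rintro h e ⟨-, hv⟩ he
    obtain ⟨w, rfl⟩ := Sym2.mem_iff_exists.1 hv
    exact h w he
  · intro h w hw
    exact h s(v, w) ⟨hw.ne, Sym2.mem_mk_left v w⟩ hw

theorem not_isDiag_of_mem_incidenceFinset {G : SimpleGraph V} [DecidableRel G.Adj] {v : V}
    {e : Sym2 V} (he : e ∈ G.incidenceFinset v) : ¬ e.IsDiag :=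
  G.not_isDiag_of_mem_edgeSet ((mem_incidenceFinset ..).1 he).1

theorem binomialRandom_real_isolated (p : unitInterval) (v : V) :
    (binomialRandom V p).real {G | ∀ w, ¬ G.Adj v w} =
      (1 - p : ℝ) ^ (Fintype.card V - 1) := by
  rw [setOf_isolated_eq, binomialRandom_real_forall_notMem_edgeSet p
    fun e he => not_isDiag_of_mem_incidenceFinset he, card_incidenceFinset_eq_degree]
  simp

/-- The two stars share exactly the edge `uv`. The factor `1 - p` restores this edge, so the
correlation excess is `1 / (1 - p) - 1 = p / (1 - p)`. -/
theorem binomialRandom_real_isolated_inter (p : unitInterval) {u v : V} (huv : u ≠ v) :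
    (binomialRandom V p).real ({G | ∀ w, ¬ G.Adj u w} ∩ {G | ∀ w, ¬ G.Adj v w}) * (1 - p) =
      (1 - p : ℝ) ^ (Fintype.card V - 1) * (1 - p : ℝ) ^ (Fintype.card V - 1) := by
  have hcard : ((⊤ : SimpleGraph V).incidenceFinset u ∪
      (⊤ : SimpleGraph V).incidenceFinset v).card + 1 =
        (Fintype.card V - 1) + (Fintype.card V - 1) := by
    have h := Finset.card_union_add_card_inter ((⊤ : SimpleGraph V).incidenceFinset u)
      ((⊤ : SimpleGraph V).incidenceFinset v)
    have hint : (⊤ : SimpleGraph V).incidenceFinset u ∩ (⊤ : SimpleGraph V).incidenceFinset v =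
        {s(u, v)} := by
      rw [← Finset.coe_inj]
      push_cast
      exact incidenceSet_inter_incidenceSet_of_adj _ huv
    rw [hint, card_incidenceFinset_eq_degree, card_incidenceFinset_eq_degree] at h
    simpa using h
  rw [← pow_add, ← hcard, pow_succ, ← binomialRandom_real_forall_notMem_edgeSet p]
  · congr 2
    rw [setOf_isolated_eq, setOf_isolated_eq, ← Set.ofPred_and]
    ext G
    simp only [Set.mem_ofPred_eq, Finset.forall_mem_union]
  · intro e he
    rcases Finset.mem_union.1 he with he | he <;> exact not_isDiag_of_mem_incidenceFinset he

/-- The second moment bound for the existence of an isolated vertex. -/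
theorem binomialRandom_real_connected_le [Nontrivial V] (p : unitInterval) (hp : (p : ℝ) < 1) :
    (binomialRandom V p).real {G | G.Connected} ≤
      1 / (Fintype.card V * (1 - p : ℝ) ^ (Fintype.card V - 1)) + p / (1 - p) := by
  have hp1 : (0 : ℝ) < 1 - p := by linarith
  have hn : (0 : ℝ) < Fintype.card V := by exact_mod_cast Fintype.card_pos
  set a : ℝ := Fintype.card V * (1 - p : ℝ) ^ (Fintype.card V - 1) with ha
  have ha0 : 0 < a := by positivity
  have hsum : ∑ v : V, (binomialRandom V p).real {G | ∀ w, ¬ G.Adj v w} = a := by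
    simp [binomialRandom_real_isolated, ha]
  have h := measureReal_le_abs_sum_indicator_sub (μ := binomialRandom V p)
    (A := fun v => {G | ∀ w, ¬ G.Adj v w}) (s := Finset.univ) (δ := p / (1 - p))
    (fun e _ => measurableSet_of_finite _) hsum (div_nonneg p.2.1 hp1.le) ?_ ha0
  · refine le_trans (measureReal_mono ?_) (h.trans_eq ?_)
    -- Without isolated vertices the count is `0`, a deviation by the full mean `a`.
    · intro G hG
      have h0 : ∑ v : V, ({G | ∀ w, ¬ G.Adj v w} : Set (SimpleGraph V)).indicator
          (fun _ => (1 : ℝ)) G = 0 := by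
        refine Finset.sum_eq_zero fun v _ => Set.indicator_of_notMem ?_ _
        simp only [Set.mem_ofPred_eq, not_forall, not_not]
        exact hG.preconnected.exists_adj_of_nontrivial v
      simp only [Set.mem_ofPred_eq]
      rw [h0, zero_sub, abs_neg, abs_of_pos ha0]
    · field_simp
  · intro u _ v _ huv
    rw [binomialRandom_real_isolated, binomialRandom_real_isolated,
      ← binomialRandom_real_isolated_inter p huv]
    refine le_of_eq ?_
    field_simp
    ring

end SimpleGraph

/-! ### Almost sure bounds on `tmc` -/

namespace TMC

theorem almostSurely_of_measureReal_not_le {P : ∀ n : ℕ, SimpleGraph (Fin n) → Prop}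
    {p : ℕ → unitInterval} {ε : ℕ → ℝ} (hε : Tendsto ε atTop (𝓝 0))
    (h : ∀ᶠ n in atTop,
      (SimpleGraph.binomialRandom (Fin n) (p n)).real {G | ¬ P n G} ≤ ε n) :
    AlmostSurely P p := by
  have h0 : Tendsto (fun n => (SimpleGraph.binomialRandom (Fin n) (p n)).real {G | ¬ P n G})
      atTop (𝓝 0) :=
    tendsto_of_tendsto_of_tendsto_of_le_of_le' tendsto_const_nhds hε
      (.of_forall fun n => measureReal_nonneg) h
  have h1 : Tendsto (fun n => (SimpleGraph.binomialRandom (Fin n) (p n)).real {G | P n G})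
      atTop (𝓝 1) := by
    have := h0.const_sub 1
    rw [sub_zero] at this
    refine this.congr fun n => ?_
    have hc : {G | ¬ P n G} = {G | P n G}ᶜ := rfl
    rw [hc, probReal_compl_eq_one_sub (SimpleGraph.measurableSet_of_finite _)]
    ring
  have h2 := ENNReal.tendsto_ofReal h1
  simpa [AlmostSurely, ofReal_measureReal] using h2

theorem tendsto_log_natCast : Tendsto (fun n : ℕ => Real.log n) atTop atTop :=
  Real.tendsto_log_atTop.comp tendsto_natCast_atTop_atTop

theorem tendsto_log_natCast_div : Tendsto (fun n : ℕ => Real.log n / n) atTop (𝓝 0) :=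
  (Real.isLittleO_log_id_atTop.tendsto_div_nhds_zero).comp tendsto_natCast_atTop_atTop

theorem tendsto_const_div_log_natCast (a : ℝ) :
    Tendsto (fun n : ℕ => a / Real.log n) atTop (𝓝 0) :=
  tendsto_const_nhds.div_atTop tendsto_log_natCast

theorem sq_div_four_le_choose_two {n : ℕ} (hn : (2 : ℝ) ≤ n) :
    (n : ℝ) ^ 2 / 4 ≤ n.choose 2 := by
  rw [Nat.cast_choose_two]
  nlinarith

theorem choose_two_le_sq_div_two (n : ℕ) : (n.choose 2 : ℝ) ≤ (n : ℝ) ^ 2 / 2 := by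
  rw [Nat.cast_choose_two]
  nlinarith [n.cast_nonneg (α := ℝ)]

/-- In the second alternative, `p ≥ 4 log n / n` makes `n exp (-p n / 2) ≤ 1 / n`, hence
connectedness, and more than half the expected number of edges, at least `f n + n`, is present. -/
theorem almostSurely_le_tmc {f : ℕ → ℝ} {p : ℕ → unitInterval}
    (h : ∀ᶠ n : ℕ in atTop, (p n = 1 ∧ f n ≤ n + (n.choose 2 : ℝ)) ∨
      (4 * (Real.log n / n) ≤ p n ∧ f n + n ≤ n.choose 2 * p n / 2)) :
    AlmostSurely (fun n G => f n ≤ (tmc G : ℝ)) p := by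
  refine almostSurely_of_measureReal_not_le
    (ε := fun n : ℕ => (Real.exp (n : ℝ)⁻¹ - 1) + 4 / Real.log n) ?_ ?_
  · have h1 : Tendsto (fun n : ℕ => Real.exp (n : ℝ)⁻¹ - 1) atTop (𝓝 0) := by
      have := (Real.continuous_exp.tendsto 0).comp
        (tendsto_inv_atTop_nhds_zero_nat (𝕜 := ℝ))
      simpa using this.sub_const 1
    simpa using h1.add (tendsto_const_div_log_natCast 4)
  filter_upwards [h, eventually_ge_atTop 3] with n hn hn3
  have hn3' : (3 : ℝ) ≤ n := by exact_mod_cast hn3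
  have hlog : 0 < Real.log n := Real.log_pos (by linarith)
  have : Nonempty (Fin n) := ⟨⟨0, by omega⟩⟩
  have hexp0 : 0 ≤ Real.exp (n : ℝ)⁻¹ - 1 := by
    have : (0 : ℝ) ≤ (n : ℝ)⁻¹ := by positivity
    linarith [Real.one_le_exp this]
  rcases hn with ⟨hp, hf⟩ | ⟨hp, hf⟩
  · have htop := card_add_ncard_edgeSet_le_tmc_top (V := Fin n)
    have hm : (⊤ : SimpleGraph (Fin n)).edgeSet.ncard = n.choose 2 := by
      classical
      rw [← SimpleGraph.coe_edgeFinset, Set.ncard_coe_finset,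
        SimpleGraph.card_edgeFinset_top_eq_card_choose_two, Fintype.card_fin]
    rw [hm, Nat.card_fin] at htop
    have hmem : f n ≤ (tmc (⊤ : SimpleGraph (Fin n)) : ℝ) :=
      hf.trans (by exact_mod_cast htop)
    have : (SimpleGraph.binomialRandom (Fin n) (p n)).real {G | ¬ f n ≤ (tmc G : ℝ)} = 0 := by
      rw [hp, SimpleGraph.binomialRandom_one, measureReal_def,
        Measure.dirac_apply' _ (SimpleGraph.measurableSet_of_finite _)]
      simp [hmem]
    rw [this]
    positivity
  set a : ℝ := n.choose 2 * p n with ha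
  have hloga : Real.log n ≤ a := by
    calc Real.log n ≤ n * Real.log n := by nlinarith
      _ = (n : ℝ) ^ 2 / 4 * (4 * (Real.log n / n)) := by field_simp
      _ ≤ n.choose 2 * p n := by
        gcongr
        exact sq_div_four_le_choose_two (by linarith)
  have ha0 : 0 < a := hlog.trans_le hloga
  have hsub : {G : SimpleGraph (Fin n) | ¬ f n ≤ (tmc G : ℝ)} ⊆
      {G | ¬ G.Connected} ∪ {G | a / 2 ≤ |(G.edgeSet.ncard : ℝ) - a|} := by
    intro G hG
    by_contra hcon
    simp only [Set.mem_union, Set.mem_ofPred_eq, not_or, not_not, not_le] at hcon hG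
    have hlt := (abs_lt.1 hcon.2).1
    have hedge := ncard_edgeSet_lt_tmc_add hcon.1
    rw [Nat.card_fin] at hedge
    have hedge' : (G.edgeSet.ncard : ℝ) + 1 ≤ tmc G + n := by exact_mod_cast hedge
    linarith
  refine (measureReal_mono hsub).trans ((measureReal_union_le _ _).trans (add_le_add ?_ ?_))
  · refine (SimpleGraph.binomialRandom_real_not_connected_le (p n)).trans ?_
    rw [Fintype.card_fin]
    gcongr
    have hexp : Real.exp (-(p n * n / 2 : ℝ)) ≤ Real.exp (-(2 * Real.log n)) := by
      rw [Real.exp_le_exp]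
      have : 4 * Real.log n ≤ p n * n := by
        rwa [← mul_div_assoc, div_le_iff₀ (by linarith)] at hp
      linarith
    calc (n : ℝ) * Real.exp (-(p n * n / 2 : ℝ)) ≤ n * Real.exp (-(2 * Real.log n)) := by gcongr
      _ = (n : ℝ)⁻¹ := by
        rw [Real.exp_neg, two_mul, Real.exp_add, Real.exp_log (by linarith)]
        field_simp
  · refine (SimpleGraph.binomialRandom_real_half_le_abs_ncard_edgeSet_sub (p n)
      (by rw [Fintype.card_fin]) ha0).trans ?_
    gcongr

theorem almostSurely_tmc_lt_of_edges {f : ℕ → ℝ} {p : ℕ → unitInterval}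
    (h : ∀ᶠ n : ℕ in atTop, Real.log n ≤ n.choose 2 * p n ∧
      3 / 2 * (n.choose 2 * p n : ℝ) + n ≤ f n) :
    AlmostSurely (fun n G => ¬ f n ≤ (tmc G : ℝ)) p := by
  refine almostSurely_of_measureReal_not_le (tendsto_const_div_log_natCast 4) ?_
  filter_upwards [h, tendsto_log_natCast.eventually_gt_atTop 0] with n ⟨hloga, hf⟩ hlog
  set a : ℝ := n.choose 2 * p n with ha
  have ha0 : 0 < a := hlog.trans_le hloga
  have hsub : {G : SimpleGraph (Fin n) | ¬ ¬ f n ≤ (tmc G : ℝ)} ⊆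
      {G | a / 2 ≤ |(G.edgeSet.ncard : ℝ) - a|} := by
    intro G hG
    simp only [Set.mem_ofPred_eq, not_not] at hG ⊢
    have hle := tmc_le G
    rw [Nat.card_fin] at hle
    have hle' : (tmc G : ℝ) ≤ n + G.edgeSet.ncard := by exact_mod_cast hle
    refine le_trans ?_ (le_abs_self _)
    linarith
  refine (measureReal_mono hsub).trans
    ((SimpleGraph.binomialRandom_real_half_le_abs_ncard_edgeSet_sub (p n)
      (by rw [Fintype.card_fin]) ha0).trans ?_)
  gcongr

/-- At this density the expected number of isolated vertices is at least `√n`, and a disconnected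
graph has `tmc G = 0 < 1 ≤ f n`. -/
theorem almostSurely_not_le_tmc_of_sparse {f : ℕ → ℝ} (hf : ∀ᶠ n in atTop, 1 ≤ f n)
    {p : ℕ → unitInterval} (hp : ∀ᶠ n : ℕ in atTop, (p n : ℝ) = 1 / 4 * (Real.log n / n)) :
    AlmostSurely (fun n G => ¬ f n ≤ (tmc G : ℝ)) p := by
  refine almostSurely_of_measureReal_not_le
    (ε := fun n : ℕ => Real.exp (-(Real.log n / 2)) + 1 / 2 * (Real.log n / n)) ?_ ?_
  · have h1 : Tendsto (fun n : ℕ => Real.exp (-(Real.log n / 2))) atTop (𝓝 0) :=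
      Real.tendsto_exp_neg_atTop_nhds_zero.comp
        (tendsto_log_natCast.atTop_div_const (by norm_num))
    have h2 := h1.add (tendsto_log_natCast_div.const_mul (1 / 2))
    rwa [mul_zero, add_zero] at h2
  filter_upwards [hf, hp, eventually_ge_atTop 2,
    tendsto_log_natCast_div.eventually_le_const (by norm_num : (0 : ℝ) < 1)]
    with n hfn hpn hn2 hsmall
  have hn2' : (2 : ℝ) ≤ n := by exact_mod_cast hn2
  have : Nontrivial (Fin n) := Fin.nontrivial_iff_two_le.2 hn2
  set x : ℝ := (p n : ℝ) with hx
  have hx0 : 0 ≤ x := (p n).2.1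
  have hx2 : x ≤ 1 / 2 := by linarith
  have hx1 : 0 < 1 - x := by linarith
  have hsub : {G : SimpleGraph (Fin n) | ¬ ¬ f n ≤ (tmc G : ℝ)} ⊆ {G | G.Connected} := by
    intro G hG
    simp only [Set.mem_ofPred_eq, not_not] at hG ⊢
    by_contra hcon
    rw [tmc, if_neg hcon] at hG
    norm_num at hG
    linarith
  refine (measureReal_mono hsub).trans
    ((SimpleGraph.binomialRandom_real_connected_le (p n) (by linarith)).trans ?_)
  rw [Fintype.card_fin, ← hx]
  have hdiv : x / (1 - x) ≤ 2 * x := by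
    rw [div_le_iff₀ hx1]; nlinarith
  refine add_le_add ?_ (by linarith)
  -- With `x = log n / (4 n)`, the `n`-th power of this bound is `n ^ (-1/2)`.
  have hone : Real.exp (-(2 * x)) ≤ 1 - x := by
    rw [← Real.le_log_iff_exp_le hx1]
    have h := Real.one_sub_inv_le_log_of_pos hx1
    have : 1 - (1 - x)⁻¹ = -(x / (1 - x)) := by field_simp; ring
    linarith
  have hpow : Real.exp (-(Real.log n / 2)) ≤ (1 - x) ^ (n - 1) := by
    calc Real.exp (-(Real.log n / 2)) = Real.exp (-(2 * x)) ^ n := by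
          rw [← Real.exp_nat_mul, hpn]; congr 1; field_simp; ring
      _ ≤ (1 - x) ^ n := by gcongr
      _ ≤ (1 - x) ^ (n - 1) := pow_le_pow_of_le_one hx1.le (by linarith) (Nat.sub_le _ _)
  rw [div_le_iff₀ (by positivity)]
  calc (1 : ℝ) = Real.exp (-(Real.log n / 2)) * (n * Real.exp (-(Real.log n / 2))) := by
        rw [mul_left_comm, ← Real.exp_add]
        have : -(Real.log n / 2) + -(Real.log n / 2) = -Real.log n := by ring
        rw [this, Real.exp_neg, Real.exp_log (by linarith)]
        field_simp
    _ ≤ _ := by gcongr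

/-! ### The two sharp thresholds -/

/-- A sequence of probabilities that eventually agrees with a given real sequence. -/
theorem exists_unitInterval_eventually_eq {t : ℕ → ℝ} (h : ∀ᶠ n in atTop, 0 ≤ t n ∧ t n ≤ 1) :
    ∃ q : ℕ → unitInterval, ∀ᶠ n in atTop, (q n : ℝ) = t n := by
  refine ⟨fun n => Set.projIcc 0 1 zero_le_one (t n), ?_⟩
  filter_upwards [h] with n hn
  rw [Set.projIcc_of_mem zero_le_one hn]

theorem isSharpThreshold_of_log_le {f : ℕ → ℝ}
    (hf : ∀ᶠ n : ℕ in atTop, f n < (1 / 2 : ℝ) * n * ((n : ℝ) - 1) + n) {l : ℝ} (hl : 0 < l)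
    (hlf : ∀ᶠ n : ℕ in atTop, l * n * Real.log n ≤ f n) :
    IsSharpThreshold (fun n : ℕ => (f n + n * Real.log (Real.log n)) / (n : ℝ) ^ 2)
      (fun n G => f n ≤ (tmc G : ℝ)) := by
  have hloglog : ∀ᶠ n : ℕ in atTop, Real.log (Real.log n) ≤ l * Real.log n := by
    have h := (Real.isLittleO_log_id_atTop.comp_tendsto tendsto_log_natCast).def hl
    filter_upwards [h, tendsto_log_natCast.eventually_ge_atTop 0] with n hn h0
    simp only [Function.comp_apply, id, Real.norm_eq_abs, abs_of_nonneg h0] at hn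
    exact (le_abs_self _).trans hn
  -- `f n` dominates `n`, and `t n` lies between `f n / n ^ 2` and `2 * f n / n ^ 2`
  have hbasic : ∀ᶠ n : ℕ in atTop, (2 : ℝ) ≤ n ∧ 16 / l ≤ n ∧ 1 ≤ Real.log n ∧ 2 * (n : ℝ) ≤ f n ∧
      f n ≤ f n + n * Real.log (Real.log n) ∧ f n + n * Real.log (Real.log n) ≤ 2 * f n := by
    filter_upwards [hloglog, hlf, tendsto_log_natCast.eventually_ge_atTop 1,
      tendsto_log_natCast.eventually_ge_atTop (2 / l),
      tendsto_natCast_atTop_atTop.eventually_ge_atTop (2 : ℝ),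
      tendsto_natCast_atTop_atTop.eventually_ge_atTop (16 / l)] with n h1 h2 h3 h4 h5 h6
    have h4' : 2 ≤ l * Real.log n := by rwa [div_le_iff₀' hl] at h4
    have h7 := Real.log_nonneg h3
    refine ⟨h5, h6, h3, ?_, ?_, ?_⟩
    · nlinarith
    · have : 0 ≤ (n : ℝ) * Real.log (Real.log n) := by positivity
      linarith
    · nlinarith
  -- The summand `4 / l` gives `p ≥ 4 log n / n`; the summand `16` makes half the expected edge
  -- count at least `2 f n ≥ f n + n`. With `c = 1 / 4` the expected edge count is at most `f n /
  -- 4`, and `3 / 2 * (f n / 4) + n ≤ 7 / 8 * f n`.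
  refine ⟨16 + 4 / l, 1 / 4, by positivity, by norm_num, fun p hp => ?_, ?_⟩
  · refine almostSurely_le_tmc ?_
    filter_upwards [hp, hf, hlf, hbasic] with n hpn hfn hlfn ⟨hn2, _, hlog, hnf, htf, _⟩
    have hn0 : (0 : ℝ) < n := by linarith
    have hf0 : 0 < f n := by linarith
    rcases min_le_iff.1 hpn with h | h
    · left
      refine ⟨Subtype.ext (le_antisymm (p n).2.2 h), ?_⟩
      rw [Nat.cast_choose_two]
      linarith
    · right
      have hlow : (16 + 4 / l) * (f n / (n : ℝ) ^ 2) ≤ p n := by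
        refine le_trans ?_ h
        gcongr
      have hq0 : 0 ≤ f n / (n : ℝ) ^ 2 := by positivity
      constructor
      · calc 4 * (Real.log n / n) = 4 / l * (l * n * Real.log n / (n : ℝ) ^ 2) := by
              field_simp
          _ ≤ 4 / l * (f n / (n : ℝ) ^ 2) := by gcongr
          _ ≤ (16 + 4 / l) * (f n / (n : ℝ) ^ 2) := by gcongr; linarith
          _ ≤ p n := hlow
      · have h16 : 16 * (f n / (n : ℝ) ^ 2) ≤ p n := by
          refine le_trans ?_ hlow
          gcongr
          have : 0 ≤ 4 / l := by positivity
          linarith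
        calc f n + n ≤ 2 * f n := by linarith
          _ = (n : ℝ) ^ 2 / 4 * (16 * (f n / (n : ℝ) ^ 2)) / 2 := by field_simp; ring
          _ ≤ n.choose 2 * p n / 2 := by
              gcongr
              exact sq_div_four_le_choose_two hn2
  · have hmem : ∀ᶠ n : ℕ in atTop,
        0 ≤ 1 / 4 * ((f n + n * Real.log (Real.log n)) / (n : ℝ) ^ 2) ∧
          1 / 4 * ((f n + n * Real.log (Real.log n)) / (n : ℝ) ^ 2) ≤ 1 := by
      filter_upwards [hf, hbasic] with n hfn ⟨hn2, _, hlog, hnf, htf, hft⟩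
      have hn0 : (0 : ℝ) < n := by linarith
      constructor
      · have : 0 ≤ f n + n * Real.log (Real.log n) := by linarith
        positivity
      · rw [← mul_div_assoc, div_le_one (by positivity)]
        nlinarith
    obtain ⟨q, hq⟩ := exists_unitInterval_eventually_eq hmem
    refine ⟨q, hq, almostSurely_tmc_lt_of_edges ?_⟩
    filter_upwards [hq, hlf, hbasic] with n hqn hlfn ⟨hn2, hnl, hlog, hnf, htf, hft⟩
    have hn0 : (0 : ℝ) < n := by linarith
    have hf0 : 0 < f n := by linarith
    rw [hqn]
    constructor
    · have hnl' : 16 ≤ l * n := by rwa [div_le_iff₀' hl] at hnl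
      -- From `16 ≤ l n` follows `16 log n ≤ l n log n ≤ f n`.
      calc Real.log n ≤ f n / 16 := by nlinarith
        _ = (n : ℝ) ^ 2 / 4 * (1 / 4 * (f n / (n : ℝ) ^ 2)) := by field_simp; ring
        _ ≤ _ := by
          gcongr
          exact sq_div_four_le_choose_two hn2
    · have hup : (n.choose 2 : ℝ) *
          (1 / 4 * ((f n + n * Real.log (Real.log n)) / (n : ℝ) ^ 2)) ≤ f n / 4 := by
        calc _ ≤ (n : ℝ) ^ 2 / 2 * (1 / 4 * (2 * f n / (n : ℝ) ^ 2)) := by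
              have : 0 ≤ f n + n * Real.log (Real.log n) := by linarith
              gcongr
              exact choose_two_le_sq_div_two n
          _ = f n / 4 := by field_simp
      linarith

theorem isSharpThreshold_of_isLittleO {f : ℕ → ℝ} (hf : ∀ᶠ n : ℕ in atTop, 1 ≤ f n)
    (hfo : f =o[atTop] fun n : ℕ => (n : ℝ) * Real.log n) :
    IsSharpThreshold (fun n : ℕ => Real.log n / (n : ℝ)) (fun n G => f n ≤ (tmc G : ℝ)) := by
  have hsmall : ∀ᶠ n : ℕ in atTop, 0 ≤ Real.log n / n ∧ 4 * (Real.log n / n) ≤ 1 := by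
    filter_upwards [tendsto_log_natCast_div.eventually_le_const (by norm_num : (0 : ℝ) < 1 / 4)]
      with n h
    exact ⟨div_nonneg (Real.log_natCast_nonneg n) n.cast_nonneg, by linarith⟩
  refine ⟨4, 1 / 4, by norm_num, by norm_num, fun p hp => ?_, ?_⟩
  · refine almostSurely_le_tmc ?_
    filter_upwards [hp, hsmall, hfo.def (by norm_num : (0 : ℝ) < 1 / 4),
      tendsto_log_natCast.eventually_ge_atTop 4, eventually_ge_atTop 2]
      with n hpn ⟨hs0, hs1⟩ hfn hlog hn2
    right
    have hn2' : (2 : ℝ) ≤ n := by exact_mod_cast hn2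
    rw [min_eq_right hs1] at hpn
    refine ⟨hpn, ?_⟩
    have hfn' : f n ≤ 1 / 4 * (n * Real.log n) := by
      have : 0 ≤ (n : ℝ) * Real.log n := by positivity
      rw [Real.norm_eq_abs, Real.norm_eq_abs, abs_of_nonneg this] at hfn
      exact (le_abs_self _).trans hfn
    -- Both `f n` and, since `log n ≥ 4`, also `n` are at most `n log n / 4`.
    calc f n + n ≤ n * Real.log n / 2 := by nlinarith
      _ = (n : ℝ) ^ 2 / 4 * (4 * (Real.log n / n)) / 2 := by field_simp
      _ ≤ n.choose 2 * p n / 2 := by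
          gcongr
          exact sq_div_four_le_choose_two hn2'
  · obtain ⟨q, hq⟩ := exists_unitInterval_eventually_eq
      (t := fun n : ℕ => 1 / 4 * (Real.log n / n))
      (hsmall.mono fun n h => ⟨by linarith [h.1], by linarith [h.1, h.2]⟩)
    exact ⟨q, hq, almostSurely_not_le_tmc_of_sparse hf hq⟩

end TMC

theorem theorem10 (f : ℕ → ℝ)
    (hf : ∀ᶠ n : ℕ in atTop, 1 ≤ f n ∧ f n < (1 / 2 : ℝ) * n * ((n : ℝ) - 1) + n) :
    (∀ l : ℝ, 0 < l → (∀ᶠ n : ℕ in atTop, l * n * Real.log n ≤ f n) →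
      TMC.IsSharpThreshold
        (fun n : ℕ => (f n + n * Real.log (Real.log n)) / (n : ℝ) ^ 2)
        (fun n G => f n ≤ (TMC.tmc G : ℝ))) ∧
    ((f =o[atTop] fun n : ℕ => (n : ℝ) * Real.log n) →
      TMC.IsSharpThreshold
        (fun n : ℕ => Real.log n / (n : ℝ))
        (fun n G => f n ≤ (TMC.tmc G : ℝ))) :=
  ⟨fun _ hl hlf => TMC.isSharpThreshold_of_log_le (hf.mono fun _ h => h.2) hl hlf,
    TMC.isSharpThreshold_of_isLittleO (hf.mono fun _ h => h.1)⟩
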